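/- Let $\rho\in(0,\tfrac12)$. There is a constant $C$, depending only on $\rho$, such that the following holds for every integer $n\ge 1$. Let $M_n=(a_{ij})_{1\le i,j\le n}$ be a random matrix whose $n^2$ entries are jointly independent real random variables, not necessarily identically distributed, and suppose that for all $i,j\in\{1,\dots,n\}$ there are real numbers $x_{ij}^-<x_{ij}^+$ with $$\mathbb{P}(a_{ij}>x_{ij}^+)>\rho\qquad\text{and}\qquad \mathbb{P}(a_{ij}<x_{ij}^-)>\rho .$$ Then $$\mathbb{P}(M_n\text{ is singular})\le \frac{C}{\sqrt n}.$$ In other words, $\mathbb{P}(M_n\text{ is singular})=O(1/\sqrt n)$ as $n\to\infty$, with an implied constant depending only on $\rho$. -/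

import Mathlib

open MeasureTheory ProbabilityTheory

/-- The uniform non-degeneracy property (H) with parameter `ρ`: every entry `a i j` of the random
matrix `M` admits two real numbers `x⁻ < x⁺` (which may depend on `i`, `j`) such that
`P(a i j > x⁺) > ρ` and `P(a i j < x⁻) > ρ`. -/
def UniformlyNondegenerate {Ω : Type*} [MeasurableSpace Ω] (P : Measure Ω) (ρ : ℝ) {n : ℕ}
    (M : Ω → Matrix (Fin n) (Fin n) ℝ) : Prop :=
  ∀ i j : Fin n, ∃ xminus xplus : ℝ, xminus < xplus ∧
    ρ < P.real {ω | xplus < M ω i j} ∧ ρ < P.real {ω | M ω i j < xminus}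

/-!
Only one consequence of the hypothesis on the entries is used: no entry takes any value with
probability more than `1 - ρ`.

*Anticoncentration.* Let `Y` have independent coordinates of this kind, and let `w` have at least
`s` nonzero coordinates. Draw two independent copies of each coordinate and then keep one of the two
by a fair coin; the law of `Y` is unchanged. Once the copies are fixed, `∑ i, w i * Y i` is a
shifted subset sum of a family with one nonzero member for each nonzero `w i` whose two copies
differ, and Sperner's theorem bounds the proportion of subsets with a given sum
(`card_sum_eq_le`). The number of such `i` is rarely less than `ρ * s / 4`, so that averaging over
the copies gives a bound of order `1 / √(ρ * s)` (`pi_hyperplane_le`).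

*Sparse normal vectors.* If a nonzero vector supported in a set `S` of at most `k` columns is
orthogonal to all the rows, some set `T` of at most `k` rows already carries all the linear
relations between these columns. Given the rows in `T`, one such relation is fixed, and each other
row satisfies it with probability at most `1 - ρ`. For `k` a small proportion of `n`, the union
bound over `S` and `T` still decays exponentially (`pi_sparseOrthogonal_le`,
`exists_card_sq_mul_pow_le`).

*Singularity.* If the matrix is singular, its rows satisfy a nontrivial relation, which by the
sparse bound for the transposed matrix may be assumed to have more than `k` terms. Then more than
`k` rows lie in the span of the others. A given row does so with probability `O(1 / √n)`: it must be
orthogonal to a normal vector of the other rows, which is independent of it and may again be assumed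
to have more than `k` nonzero coordinates (`pi_row_mem_span_le`). Markov's inequality for the number
of such rows loses only the constant factor `n / k` (`measure_not_isUnit_le`).

Events quantified over a vector are projections of closed sets along a finite-dimensional space,
which makes them measurable (`measurableSet_exists_of_isClosed`), as Fubini requires.
-/

/-! ### Subset sums -/

theorem Nat.centralBinom_sq_mul_le (m : ℕ) : m.centralBinom ^ 2 * (2 * m + 1) ≤ 16 ^ m := by
  induction m with
  | zero => simp
  | succ m ih =>
    have h := Nat.succ_mul_centralBinom_succ m
    have hpos : 0 < (m + 1) ^ 2 := by positivity
    refine Nat.le_of_mul_le_mul_left ?_ hpos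
    calc (m + 1) ^ 2 * ((m + 1).centralBinom ^ 2 * (2 * (m + 1) + 1))
        = ((m + 1) * (m + 1).centralBinom) ^ 2 * (2 * m + 3) := by ring
      _ = (m.centralBinom ^ 2 * (2 * m + 1)) * (4 * ((2 * m + 1) * (2 * m + 3))) := by
          rw [h]; ring
      _ ≤ 16 ^ m * (4 * (4 * (m + 1) ^ 2)) := by
          refine Nat.mul_le_mul ih (Nat.mul_le_mul_left 4 ?_)
          nlinarith
      _ = (m + 1) ^ 2 * 16 ^ (m + 1) := by ring

theorem Nat.choose_half_sq_mul_le (d : ℕ) : (d.choose (d / 2)) ^ 2 * (d + 1) ≤ 4 ^ d := by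
  obtain ⟨m, rfl | rfl⟩ := Nat.even_or_odd' d
  · have h := Nat.centralBinom_sq_mul_le m
    rw [Nat.centralBinom_eq_two_mul_choose] at h
    rw [Nat.mul_div_cancel_left _ two_pos, pow_mul]
    exact h
  · have h := Nat.centralBinom_sq_mul_le (m + 1)
    have h2 : (m + 1).centralBinom = 2 * (2 * m + 1).choose m := by
      rw [Nat.centralBinom_eq_two_mul_choose, show 2 * (m + 1) = 2 * m + 1 + 1 by ring,
        Nat.choose_succ_succ, Nat.choose_symm_half]
      ring
    rw [h2] at h
    rw [show (2 * m + 1) / 2 = m by omega]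
    have h16 : (16 : ℕ) ^ (m + 1) = 4 * 4 ^ (2 * m + 1) := by
      rw [show (16 : ℕ) = 4 ^ 2 by norm_num, ← pow_mul, ← pow_succ']
      congr 1
    rw [h16] at h
    nlinarith [Nat.zero_le ((2 * m + 1).choose m ^ 2)]

theorem Nat.choose_half_le (d : ℕ) :
    ((d.choose (d / 2) : ℕ) : ℝ) ≤ 2 ^ d / √(d + 1) := by
  have h : ((d.choose (d / 2) : ℕ) : ℝ) ^ 2 * (d + 1) ≤ 4 ^ d := by
    exact_mod_cast Nat.choose_half_sq_mul_le d
  have hs : 0 < √((d : ℝ) + 1) := Real.sqrt_pos.2 (by positivity)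
  rw [le_div_iff₀ hs]
  refine abs_le_of_sq_le_sq' ?_ (by positivity) |>.2
  rw [mul_pow, Real.sq_sqrt (by positivity), ← pow_mul, mul_comm d 2, pow_mul]
  norm_num
  exact h

/-- **Littlewood–Offord**, for coefficients none of which vanishes. -/
theorem card_sum_eq_le_of_ne_zero {α : Type*} [Fintype α] [DecidableEq α] (c : α → ℝ)
    (hc : ∀ i, c i ≠ 0) (b : ℝ) :
    (Finset.univ.filter fun A : Finset α => ∑ i ∈ A, c i = b).card ≤
      (Fintype.card α).choose (Fintype.card α / 2) := by
  classical
  -- Taking the symmetric difference with `N` replaces `c` by `|c|` up to a constant, and the sets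
  -- with a given sum of positive terms form an antichain.
  let N : Finset α := Finset.univ.filter fun i => c i < 0
  let F := Finset.univ.filter fun A : Finset α => ∑ i ∈ A, c i = b
  have hinj : Function.Injective fun A : Finset α => symmDiff A N :=
    symmDiff_left_injective N
  have habs : ∀ A : Finset α, ∑ i ∈ symmDiff A N, |c i| = ∑ i ∈ A, c i + ∑ i ∈ N, |c i| := by
    intro A
    have e : ∀ B : Finset α, ∀ f : α → ℝ, ∑ i ∈ B, f i = ∑ i, if i ∈ B then f i else 0 := by
      intro B f; rw [Finset.sum_ite_mem, Finset.univ_inter]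
    rw [e _ (fun i => |c i|), e A, e N, ← Finset.sum_add_distrib]
    refine Finset.sum_congr rfl fun i _ => ?_
    have hN : i ∈ N ↔ c i < 0 := by simp [N]
    simp only [Finset.mem_symmDiff, hN]
    by_cases hA : i ∈ A <;> by_cases h0 : c i < 0
    · simp [hA, h0, abs_of_neg]
    · simp [hA, h0, abs_of_nonneg (not_lt.1 h0)]
    · simp [hA, h0]
    · simp [hA, h0]
  have hanti : IsAntichain (· ⊆ ·) ((F.image fun A => symmDiff A N : Finset (Finset α)) :
      Set (Finset α)) := by
    intro A hA B hB hne hsub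
    have key : ∀ A ∈ F.image (fun A => symmDiff A N), ∑ i ∈ A, |c i| = b + ∑ i ∈ N, |c i| := by
      intro A hA
      obtain ⟨A', hA', rfl⟩ := Finset.mem_image.1 hA
      rw [habs, (Finset.mem_filter.1 hA').2]
    have hss : A ⊂ B := lt_of_le_of_ne hsub hne
    obtain ⟨i, hiB, hiA⟩ := Finset.exists_of_ssubset hss
    have : ∑ i ∈ A, |c i| < ∑ i ∈ B, |c i| :=
      Finset.sum_lt_sum_of_subset hsub hiB hiA (abs_pos.2 (hc i)) fun _ _ _ => abs_nonneg _
    rw [key A hA, key B hB] at this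
    exact lt_irrefl _ this
  have := hanti.sperner
  rwa [Finset.card_image_of_injective _ hinj] at this

/-- **Littlewood–Offord**: at most a fraction `1 / √(d + 1)` of the subset sums of a finite family
with `d` nonzero members are equal to a given number. -/
theorem card_sum_eq_le {α : Type*} [Fintype α] [DecidableEq α] (c : α → ℝ) (b : ℝ) :
    ((Finset.univ.filter fun A : Finset α => ∑ i ∈ A, c i = b).card : ℝ) ≤
      2 ^ Fintype.card α / √((Finset.univ.filter fun i => c i ≠ 0).card + 1) := by
  classical
  set D := Finset.univ.filter fun i => c i ≠ 0 with hD
  set F := Finset.univ.filter fun A : Finset α => ∑ i ∈ A, c i = b with hF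
  -- Only the trace of a subset on `D` matters for its sum.
  let G := Finset.univ.filter fun A : Finset D => ∑ i ∈ A, c i = b
  have hmaps : F.card ≤ (G ×ˢ Dᶜ.powerset).card := by
    refine Finset.card_le_card_of_injOn (fun A => (A.subtype (· ∈ D), A \ D)) ?_ ?_
    · intro A hA
      have hA' : ∑ i ∈ A, c i = b := (Finset.mem_filter.1 hA).2
      simp only [Finset.coe_product, Set.mem_prod, Finset.mem_coe, G, Finset.mem_filter,
        Finset.mem_univ, true_and, Finset.mem_powerset]
      constructor
      · rw [Finset.sum_subtype_eq_sum_filter, ← hA', Finset.sum_filter]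
        refine Finset.sum_congr rfl fun i _ => ?_
        by_cases h : c i = 0 <;> simp [hD, h]
      · intro i hi
        simp only [Finset.mem_sdiff] at hi
        simpa using hi.2
    · intro A _ B _ h
      simp only [Prod.mk.injEq] at h
      ext i
      by_cases hi : i ∈ D
      · have := Finset.ext_iff.1 h.1 ⟨i, hi⟩
        simpa using this
      · have := Finset.ext_iff.1 h.2 i
        simpa [hi] using this
  have hG : G.card ≤ D.card.choose (D.card / 2) := by
    have := card_sum_eq_le_of_ne_zero (fun i : D => c i)
      (fun i => (Finset.mem_filter.1 i.2).2) b
    simpa [G] using this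
  have hcard : (F.card : ℝ) ≤ D.card.choose (D.card / 2) * 2 ^ (Fintype.card α - D.card) := by
    rw [Finset.card_product, Finset.card_powerset, Finset.card_compl] at hmaps
    exact_mod_cast hmaps.trans (Nat.mul_le_mul_right _ hG)
  calc (F.card : ℝ) ≤ D.card.choose (D.card / 2) * 2 ^ (Fintype.card α - D.card) := hcard
    _ ≤ 2 ^ D.card / √(D.card + 1) * 2 ^ (Fintype.card α - D.card) := by
        gcongr
        exact Nat.choose_half_le _
    _ = 2 ^ Fintype.card α / √(D.card + 1) := by
        rw [div_mul_eq_mul_div, ← pow_add, Nat.add_sub_cancel' (Finset.card_le_univ D)]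

/-! ### Anticoncentration of linear forms -/

/-- Two independent copies of a variable without atoms of mass more than `1 - ρ` differ with
probability at least `ρ`. -/
theorem prod_self_diagonal_le {μ : Measure ℝ} [IsProbabilityMeasure μ] {ρ : ℝ} (hρ : ρ ≤ 1)
    (h : ∀ x, μ.real {x} ≤ 1 - ρ) : (μ.prod μ).real {z | z.1 = z.2} ≤ 1 - ρ := by
  have hm : MeasurableSet {z : ℝ × ℝ | z.1 = z.2} :=
    measurableSet_eq_fun measurable_fst measurable_snd
  have : (μ.prod μ) {z | z.1 = z.2} ≤ ENNReal.ofReal (1 - ρ) := by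
    rw [Measure.prod_apply hm]
    calc ∫⁻ x, μ (Prod.mk x ⁻¹' {z : ℝ × ℝ | z.1 = z.2}) ∂μ
        ≤ ∫⁻ _, ENNReal.ofReal (1 - ρ) ∂μ := by
          refine lintegral_mono fun x => ?_
          have : Prod.mk x ⁻¹' {z : ℝ × ℝ | z.1 = z.2} = {x} := by
            ext y; simp [eq_comm]
          rw [this, ENNReal.le_ofReal_iff_toReal_le (measure_ne_top _ _) (by linarith)]
          exact h x
      _ = ENNReal.ofReal (1 - ρ) := by simp
  exact ENNReal.toReal_le_of_le_ofReal (by linarith) this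

/-- Replacing each coordinate by one of two independent copies, chosen according to a fixed set of
coordinates, does not change a product law. -/
theorem measurePreserving_pi_choice {κ : Type*} [Fintype κ] [DecidableEq κ] (μ : κ → Measure ℝ)
    [∀ i, IsProbabilityMeasure (μ i)] (A : Finset κ) :
    MeasurePreserving (fun (z : κ → ℝ × ℝ) i => if i ∈ A then (z i).1 else (z i).2)
      (Measure.pi fun i => (μ i).prod (μ i)) (Measure.pi μ) := by
  refine measurePreserving_pi (fun i => (μ i).prod (μ i)) μ
    (f := fun i p => if i ∈ A then p.1 else p.2) fun i => ?_
  by_cases h : i ∈ A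
  · simpa [h] using (measurePreserving_fst (μ := μ i) (ν := μ i))
  · simpa [h] using (measurePreserving_snd (μ := μ i) (ν := μ i))

/-- An elementary bound on the Littlewood–Offord factor, good for `d` of order at least `r`, and
exponentially weighted otherwise so that it can be averaged over a product measure. -/
theorem one_div_sqrt_succ_le {r : ℝ} (hr : 0 < r) (d : ℕ) :
    1 / √((d : ℝ) + 1) ≤ 1 / √r + Real.exp r * (1 / 2) ^ d := by
  have hs : 0 < √r := Real.sqrt_pos.2 hr
  rcases le_total r d with h | h
  · have : 1 / √((d : ℝ) + 1) ≤ 1 / √r := by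
      apply one_div_le_one_div_of_le hs
      exact Real.sqrt_le_sqrt (by linarith)
    have : 0 ≤ Real.exp r * (1 / 2) ^ d := by positivity
    linarith
  · have h1 : 1 / √((d : ℝ) + 1) ≤ 1 := by
      rw [div_le_one (Real.sqrt_pos.2 (by positivity))]
      exact Real.one_le_sqrt.2 (by linarith [(Nat.cast_nonneg d : (0 : ℝ) ≤ d)])
    have h2 : 1 ≤ Real.exp r * (1 / 2) ^ d := by
      have h3 : (2 : ℝ) ^ d ≤ Real.exp r := by
        calc (2 : ℝ) ^ d ≤ Real.exp 1 ^ d := by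
              gcongr
              linarith [Real.add_one_le_exp (1 : ℝ)]
          _ = Real.exp d := by rw [← Real.exp_nat_mul, mul_one]
          _ ≤ Real.exp r := Real.exp_le_exp.2 h
      rw [one_div, inv_pow, ← div_eq_mul_inv, one_le_div (by positivity)]
      exact h3
    have : 0 ≤ 1 / √r := by positivity
    linarith

/-- **Littlewood–Offord** for independent, not identically distributed coordinates. -/
theorem pi_hyperplane_le {κ : Type*} [Fintype κ] (μ : κ → Measure ℝ)
    [∀ i, IsProbabilityMeasure (μ i)] {ρ : ℝ} (hρ : 0 < ρ) (hρ1 : ρ ≤ 1)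
    (h : ∀ i x, (μ i).real {x} ≤ 1 - ρ) (w : κ → ℝ) {s : ℕ} (hs : 0 < s)
    (hw : s ≤ (Finset.univ.filter fun i => w i ≠ 0).card) :
    (Measure.pi μ).real {y | ∑ i, w i * y i = 0} ≤ 4 / √(ρ * s) := by
  classical
  set ν := Measure.pi fun i => (μ i).prod (μ i) with hν
  set E : Set (κ → ℝ) := {y | ∑ i, w i * y i = 0} with hE
  have hEm : MeasurableSet E :=
    measurableSet_eq_fun (Finset.measurable_sum _ fun i _ => (measurable_pi_apply i).const_mul _)
      measurable_const
  let T : Finset κ → (κ → ℝ × ℝ) → (κ → ℝ) := fun A z i => if i ∈ A then (z i).1 else (z i).2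
  have hT : ∀ A, MeasurePreserving (T A) ν (Measure.pi μ) := measurePreserving_pi_choice μ
  -- `∏ i, f i (z i)` is `(1 / 2) ^ d`, where `d` counts the nonzero terms left to the coins.
  let f : κ → ℝ × ℝ → ℝ := fun i z => if w i ≠ 0 ∧ z.1 ≠ z.2 then 1 / 2 else 1
  have hDm : MeasurableSet {z : ℝ × ℝ | z.1 = z.2} :=
    measurableSet_eq_fun measurable_fst measurable_snd
  have hf : ∀ i, f i = fun z => if w i = 0 then 1 else
      1 / 2 + {z : ℝ × ℝ | z.1 = z.2}.indicator (fun _ => (1 / 2 : ℝ)) z := by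
    intro i
    funext z
    by_cases h0 : w i = 0
    · simp [f, h0]
    · by_cases hz : z.1 = z.2 <;> simp [f, h0, hz]
      norm_num
  have hfi : ∀ i, Integrable (f i) ((μ i).prod (μ i)) := by
    intro i
    rw [hf]
    by_cases h0 : w i = 0
    · simp [h0]
    · simp only [h0, if_false]
      exact (integrable_const _).add ((integrable_const _).indicator hDm)
  have hfint : ∀ i, ∫ z, f i z ∂((μ i).prod (μ i)) ≤ if w i = 0 then 1 else 1 - ρ / 2 := by
    intro i
    rw [hf]
    by_cases h0 : w i = 0
    · simp [h0]
    · simp only [h0, if_false]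
      rw [integral_add (integrable_const _) ((integrable_const _).indicator hDm),
        integral_indicator_const _ hDm]
      have := prod_self_diagonal_le hρ1 (h i)
      simp only [integral_const, probReal_univ, smul_eq_mul, one_mul]
      linarith
  have hprod : ∫ z, ∏ i, f i (z i) ∂ν ≤ (1 - ρ / 2) ^ s := by
    rw [hν, integral_fintype_prod_eq_prod]
    calc ∏ i, ∫ z, f i z ∂((μ i).prod (μ i))
        ≤ ∏ i, if w i = 0 then 1 else 1 - ρ / 2 := by
          refine Finset.prod_le_prod (fun i _ => integral_nonneg fun z => ?_) fun i _ => hfint i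
          simp only [f, Pi.zero_apply]
          split_ifs <;> norm_num
      _ = (1 - ρ / 2) ^ (Finset.univ.filter fun i => w i ≠ 0).card := by
          rw [Finset.prod_ite, Finset.prod_const_one, one_mul, Finset.prod_const]
      _ ≤ (1 - ρ / 2) ^ s := pow_le_pow_of_le_one (by linarith) (by linarith) hw
  set r : ℝ := ρ * s / 4 with hr
  have hs' : (0 : ℝ) < s := by exact_mod_cast hs
  have hr0 : 0 < r := by positivity
  have hpoint : ∀ z : κ → ℝ × ℝ, ∑ A : Finset κ, (T A ⁻¹' E).indicator (fun _ => (1 : ℝ)) z ≤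
      2 ^ Fintype.card κ * (1 / √r + Real.exp r * ∏ i, f i (z i)) := by
    intro z
    let c : κ → ℝ := fun i => w i * ((z i).1 - (z i).2)
    have h1 : ∑ A : Finset κ, (T A ⁻¹' E).indicator (fun _ => (1 : ℝ)) z =
        (Finset.univ.filter fun A : Finset κ =>
          ∑ i ∈ A, c i = -∑ i, w i * (z i).2).card := by
      rw [Finset.card_filter]
      push_cast
      refine Finset.sum_congr rfl fun A _ => ?_
      have : z ∈ T A ⁻¹' E ↔ ∑ i ∈ A, c i = -∑ i, w i * (z i).2 := by
        rw [Set.mem_preimage, hE, Set.mem_ofPred_eq, eq_neg_iff_add_eq_zero]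
        have : ∑ i, w i * T A z i = ∑ i ∈ A, c i + ∑ i, w i * (z i).2 := by
          rw [← Finset.univ_inter A, ← Finset.sum_ite_mem, ← Finset.sum_add_distrib]
          refine Finset.sum_congr rfl fun i _ => ?_
          by_cases hi : i ∈ A
          · simp [T, hi, c]
            ring
          · simp [T, hi]
        rw [this]
      simp only [Set.indicator_apply, this]
    have h2 : ∏ i, f i (z i) = (1 / 2) ^ (Finset.univ.filter fun i => c i ≠ 0).card := by
      rw [Finset.prod_ite, Finset.prod_const_one, mul_one, Finset.prod_const]
      congr 2
      ext i
      simp [c, sub_eq_zero]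
    rw [h1, h2]
    refine (card_sum_eq_le c _).trans ?_
    rw [div_eq_mul_one_div]
    gcongr
    exact one_div_sqrt_succ_le hr0 _
  have hint : Integrable (fun z : κ → ℝ × ℝ => ∏ i, f i (z i)) ν :=
    Integrable.fintype_prod hfi
  have havg : 2 ^ Fintype.card κ * (Measure.pi μ).real E =
      ∫ z, ∑ A : Finset κ, (T A ⁻¹' E).indicator (fun _ => (1 : ℝ)) z ∂ν := by
    rw [integral_finsetSum _ fun A _ => (integrable_const _).indicator ((hT A).measurable hEm)]
    simp_rw [integral_indicator_const _ ((hT _).measurable hEm)]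
    have : ∀ A, ν.real (T A ⁻¹' E) = (Measure.pi μ).real E := fun A => by
      rw [Measure.real, (hT A).measure_preimage hEm.nullMeasurableSet, Measure.real]
    simp [this]
  have hmain : 2 ^ Fintype.card κ * (Measure.pi μ).real E ≤
      2 ^ Fintype.card κ * (1 / √r + Real.exp r * (1 - ρ / 2) ^ s) := by
    rw [havg]
    calc _ ≤ ∫ z, 2 ^ Fintype.card κ * (1 / √r + Real.exp r * ∏ i, f i (z i)) ∂ν := by
          refine integral_mono ?_ ?_ hpoint
          · exact integrable_finsetSum _ fun A _ =>
              (integrable_const _).indicator ((hT A).measurable hEm)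
          · exact ((integrable_const _).add (hint.const_mul _)).const_mul _
      _ = 2 ^ Fintype.card κ * (1 / √r + Real.exp r * ∫ z, ∏ i, f i (z i) ∂ν) := by
          rw [integral_const_mul, integral_add (integrable_const _) (hint.const_mul _),
            integral_const_mul]
          simp
      _ ≤ _ := by gcongr
  have hmain' := le_of_mul_le_mul_left hmain (by positivity)
  have hpow : (1 - ρ / 2) ^ s ≤ Real.exp (-(2 * r)) := by
    calc (1 - ρ / 2) ^ s ≤ Real.exp (-(ρ / 2)) ^ s :=
          pow_le_pow_left₀ (by linarith) (Real.one_sub_le_exp_neg _) _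
      _ = Real.exp (-(2 * r)) := by rw [← Real.exp_nat_mul, hr]; congr 1; ring
  have hexp : Real.exp r * (1 - ρ / 2) ^ s ≤ 1 / √r := by
    calc Real.exp r * (1 - ρ / 2) ^ s ≤ Real.exp r * Real.exp (-(2 * r)) := by gcongr
      _ = 1 / Real.exp r := by rw [← Real.exp_add, one_div, ← Real.exp_neg]; congr 1; ring
      _ ≤ 1 / √r := by
          apply one_div_le_one_div_of_le (Real.sqrt_pos.2 hr0)
          nlinarith [Real.add_one_le_exp r, Real.sq_sqrt hr0.le, sq_nonneg (√r - 1)]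
  have hsqrt : 1 / √r = 2 / √(ρ * s) := by
    rw [hr, show ρ * s / 4 = ρ * s / 2 ^ 2 by norm_num, Real.sqrt_div (by positivity),
      Real.sqrt_sq (by norm_num), one_div_div]
  calc (Measure.pi μ).real E ≤ 1 / √r + 1 / √r := by linarith
    _ = 4 / √(ρ * s) := by rw [hsqrt]; ring

/-! ### Sparse normal vectors -/

/-- The projection of a closed set along a finite-dimensional space is a countable union of closed
sets, hence measurable. -/
theorem measurableSet_exists_of_isClosed {X κ : Type*} [Fintype κ] [TopologicalSpace X]
    [MeasurableSpace X] [OpensMeasurableSpace X] {C : Set (X × (κ → ℝ))} (hC : IsClosed C) :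
    MeasurableSet {x | ∃ v, (x, v) ∈ C} := by
  have : {x | ∃ v, (x, v) ∈ C} =
      ⋃ N : ℕ, Prod.fst '' ((fun q : X × Metric.closedBall (0 : κ → ℝ) N => (q.1, q.2.1)) ⁻¹' C) := by
    ext x
    simp only [Set.mem_iUnion, Set.mem_image, Set.mem_preimage]
    constructor
    · rintro ⟨v, hv⟩
      obtain ⟨N, hN⟩ := exists_nat_ge ‖v‖
      exact ⟨N, (x, ⟨v, by simpa using hN⟩), hv, rfl⟩
    · rintro ⟨N, ⟨y, v⟩, hv, rfl⟩
      exact ⟨v, hv⟩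
  rw [this]
  refine MeasurableSet.iUnion fun N => IsClosed.measurableSet ?_
  have : CompactSpace (Metric.closedBall (0 : κ → ℝ) N) :=
    isCompact_iff_compactSpace.1 (isCompact_closedBall _ _)
  exact isClosedMap_fst_of_compactSpace _ (hC.preimage (by fun_prop))

/-- Fubini for a product of probability measures, as a bound by sections: the coordinates outside
`p` are frozen at those of a point `z₀` of the set, and the section through `z₀` is contained in a
box. -/
theorem pi_le_of_section_subset_box {ι : Type*} [Fintype ι] {α : ι → Type*}
    [∀ i, MeasurableSpace (α i)] (μ : ∀ i, Measure (α i)) [∀ i, IsProbabilityMeasure (μ i)]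
    (p : ι → Prop) [DecidablePred p] {E : Set (∀ i, α i)} (hE : MeasurableSet E) {c : ENNReal}
    (h : ∀ z₀ ∈ E, ∃ B : ∀ i, Set (α i),
      (∀ z ∈ E, (∀ i, ¬ p i → z i = z₀ i) → ∀ i, p i → z i ∈ B i) ∧
      ∏ i ∈ Finset.univ.filter p, μ i (B i) ≤ c) :
    Measure.pi μ E ≤ c := by
  let e := MeasurableEquiv.piEquivPiSubtypeProd α p
  have he := (measurePreserving_piEquivPiSubtypeProd μ p).symm e
  rw [← he.measure_preimage hE.nullMeasurableSet, Measure.prod_apply_symm (e.symm.measurable hE)]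
  calc _ ≤ ∫⁻ _, c ∂(Measure.pi fun i : {i // ¬ p i} => μ i) := by
        refine lintegral_mono fun y => ?_
        rcases Set.eq_empty_or_nonempty
          ((fun x => (x, y)) ⁻¹' (e.symm ⁻¹' E)) with h0 | ⟨x₀, hx₀⟩
        · rw [h0]; simp
        · obtain ⟨B, hB, hc⟩ := h _ hx₀
          have hsub : ((fun x => (x, y)) ⁻¹' (e.symm ⁻¹' E)) ⊆
              Set.pi Set.univ fun i : {i // p i} => B i := by
            intro x hx i _
            have := hB _ hx (fun j hj => by
              simp [e, MeasurableEquiv.piEquivPiSubtypeProd, Equiv.piEquivPiSubtypeProd, hj]) i i.2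
            simpa [e, MeasurableEquiv.piEquivPiSubtypeProd, Equiv.piEquivPiSubtypeProd, i.2]
              using this
          refine (measure_mono hsub).trans ?_
          rw [Measure.pi_pi]
          refine le_trans (le_of_eq ?_) hc
          exact (Finset.prod_subtype (Finset.univ.filter p) (by simp) fun i => μ i (B i)).symm
    _ = c := by simp

/-- A hyperplane has mass at most `1 - ρ` under a product of measures without atoms of mass more
than `1 - ρ`. -/
theorem pi_hyperplane_le_one_sub {κ : Type*} [Fintype κ] (μ : κ → Measure ℝ)
    [∀ i, IsProbabilityMeasure (μ i)] {q : ENNReal}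
    (h : ∀ i x, μ i {x} ≤ q) {w : κ → ℝ} (hw : w ≠ 0) :
    Measure.pi μ {y | ∑ i, w i * y i = 0} ≤ q := by
  classical
  obtain ⟨j, hj⟩ := Function.ne_iff.1 hw
  refine pi_le_of_section_subset_box μ (· = j)
    (measurableSet_eq_fun (by fun_prop) measurable_const) fun z₀ hz₀ => ?_
  refine ⟨fun i => {z₀ i}, ?_, ?_⟩
  · rintro z hz hzz i rfl
    have hz₁ : ∑ l, w l * z l = ∑ l, w l * z₀ l := hz.trans hz₀.symm
    rw [← Finset.add_sum_erase _ _ (Finset.mem_univ i),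
      ← Finset.add_sum_erase (a := i) _ (fun l => w l * z₀ l) (Finset.mem_univ i),
      Finset.sum_congr rfl fun l hl => by rw [hzz l (Finset.ne_of_mem_erase hl)]] at hz₁
    exact mul_left_cancel₀ hj (add_right_cancel hz₁)
  · rw [Finset.filter_eq' Finset.univ j, if_pos (Finset.mem_univ j), Finset.prod_singleton]
    exact h j _

/-- The arrays `x` some `k`-sparse nonzero vector of which is orthogonal to all the rows `x i`,
`i ∈ R`. -/
def sparseOrthogonal {ι κ : Type*} [Fintype κ] (R : Finset ι) (k : ℕ) : Set (ι → κ → ℝ) :=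
  {x | ∃ w : κ → ℝ, w ≠ 0 ∧ (Finset.univ.filter fun j => w j ≠ 0).card ≤ k ∧
    ∀ i ∈ R, ∑ j, w j * x i j = 0}

theorem measurableSet_exists_orthogonal {ι κ : Type*} [Fintype ι] [Fintype κ] (R : Finset ι)
    (S : Finset κ) :
    MeasurableSet {x : ι → κ → ℝ | ∃ w : κ → ℝ, w ≠ 0 ∧ (∀ l ∉ S, w l = 0) ∧
      ∀ i ∈ R, ∑ l, w l * x i l = 0} := by
  -- The open condition `w ≠ 0` is replaced by a normalisation `w j = 1`.
  have : {x : ι → κ → ℝ | ∃ w : κ → ℝ, w ≠ 0 ∧ (∀ l ∉ S, w l = 0) ∧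
      ∀ i ∈ R, ∑ l, w l * x i l = 0} = ⋃ j : κ, {x | ∃ w : κ → ℝ, (x, w) ∈
        {q : (ι → κ → ℝ) × (κ → ℝ) | q.2 j = 1 ∧ (∀ l ∉ S, q.2 l = 0) ∧
          ∀ i ∈ R, ∑ l, q.2 l * q.1 i l = 0}} := by
    ext x
    simp only [Set.mem_iUnion, Set.mem_ofPred_eq]
    constructor
    · rintro ⟨w, hw, hS, hR⟩
      obtain ⟨j, hj⟩ := Function.ne_iff.1 hw
      refine ⟨j, fun l => (w j)⁻¹ * w l, inv_mul_cancel₀ hj, fun l hl => by simp [hS l hl],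
        fun i hi => ?_⟩
      simp only [mul_assoc, ← Finset.mul_sum, hR i hi, mul_zero]
    · rintro ⟨j, w, hj, hS, hR⟩
      exact ⟨w, fun h => by simp [h] at hj, hS, hR⟩
  rw [this]
  refine MeasurableSet.iUnion fun j => measurableSet_exists_of_isClosed ?_
  simp only [Set.ofPred_and, Set.ofPred_forall]
  refine (isClosed_eq (by fun_prop) continuous_const).inter
    ((isClosed_iInter fun l => isClosed_iInter fun _ => isClosed_eq (by fun_prop)
      continuous_const).inter (isClosed_iInter fun i => isClosed_iInter fun _ =>
        isClosed_eq (by fun_prop) continuous_const))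

theorem sparseOrthogonal_eq_iUnion {ι κ : Type*} [Fintype κ] (R : Finset ι) (k : ℕ) :
    (sparseOrthogonal R k : Set (ι → κ → ℝ)) = ⋃ S : {S : Finset κ // S.card ≤ k},
      {x | ∃ w : κ → ℝ, w ≠ 0 ∧ (∀ l ∉ S.1, w l = 0) ∧ ∀ i ∈ R, ∑ l, w l * x i l = 0} := by
  classical
  ext x
  simp only [Set.mem_iUnion, sparseOrthogonal, Set.mem_ofPred_eq]
  constructor
  · rintro ⟨w, hw, hk, hR⟩
    exact ⟨⟨_, hk⟩, w, hw, by simp, hR⟩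
  · rintro ⟨⟨S, hS⟩, w, hw, hl, hR⟩
    refine ⟨w, hw, (Finset.card_le_card fun l h => ?_).trans hS, hR⟩
    by_contra hlS
    exact (Finset.mem_filter.1 h).2 (hl l hlS)

theorem measurableSet_sparseOrthogonal {ι κ : Type*} [Fintype ι] [Fintype κ] (R : Finset ι)
    (k : ℕ) : MeasurableSet (sparseOrthogonal R k : Set (ι → κ → ℝ)) := by
  rw [sparseOrthogonal_eq_iUnion]
  exact MeasurableSet.iUnion fun S => measurableSet_exists_orthogonal R S.1

theorem measurableSet_exists_orthogonal_eq_one {ι κ : Type*} [Fintype ι] [Fintype κ]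
    (T : Finset ι) (S : Finset κ) (i : ι) :
    MeasurableSet {x : ι → κ → ℝ | ∃ w : κ → ℝ, (∀ l ∉ S, w l = 0) ∧
      (∀ i ∈ T, ∑ l, w l * x i l = 0) ∧ ∑ l, w l * x i l = 1} := by
  refine measurableSet_exists_of_isClosed (C := {q : (ι → κ → ℝ) × (κ → ℝ) |
    (∀ l ∉ S, q.2 l = 0) ∧ (∀ i ∈ T, ∑ l, q.2 l * q.1 i l = 0) ∧
      ∑ l, q.2 l * q.1 i l = 1}) ?_
  simp only [Set.ofPred_and, Set.ofPred_forall]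
  exact (isClosed_iInter fun l => isClosed_iInter fun _ => isClosed_eq (by fun_prop)
      continuous_const).inter ((isClosed_iInter fun i => isClosed_iInter fun _ =>
        isClosed_eq (by fun_prop) continuous_const).inter
          (isClosed_eq (by fun_prop) continuous_const))

/-- Among the rows in `R`, restricted to the columns in `S`, at most `#S` rows carry all linear
relations. -/
theorem exists_small_row_basis {ι κ : Type*} [Fintype ι] [Fintype κ] (x : ι → κ → ℝ)
    (R : Finset ι) (S : Finset κ) :
    ∃ T ⊆ R, T.card ≤ S.card ∧ ∀ w : κ → ℝ, (∀ l ∉ S, w l = 0) →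
      (∀ i ∈ T, ∑ l, w l * x i l = 0) → ∀ i ∈ R, ∑ l, w l * x i l = 0 := by
  classical
  let v : ι → (S → ℝ) := fun i l => x i l
  obtain ⟨b, hbR, -, hspan, hli⟩ := exists_linearIndepOn_extension (K := ℝ) (v := v)
    (s := ∅) (t := (R : Set ι)) (linearIndepOn_empty ℝ v) (Set.empty_subset _)
  refine ⟨b.toFinset, fun i hi => hbR (by simpa using hi), ?_, fun w hS hT i hi => ?_⟩
  · have := hli.fintype_card_le_finrank
    simpa [Set.toFinset_card] using this
  · let φ : (S → ℝ) →ₗ[ℝ] ℝ := ∑ l : S, w l • LinearMap.proj l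
    have hφ : ∀ i, φ (v i) = ∑ l, w l * x i l := by
      intro i
      simp only [φ, v, LinearMap.sum_apply, LinearMap.smul_apply, LinearMap.proj_apply,
        smul_eq_mul]
      rw [Finset.sum_coe_sort S fun l => w l * x i l]
      exact Finset.sum_subset (Finset.subset_univ _) fun l _ hl => by simp [hS l hl]
    have hle : Submodule.span ℝ (v '' b) ≤ LinearMap.ker φ := by
      rw [Submodule.span_le]
      rintro _ ⟨i, hi, rfl⟩
      exact (hφ i).trans (hT i (by simpa using hi))
    rw [← hφ]
    exact hle (hspan ⟨i, hi, rfl⟩)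

/-- A sparse vector orthogonal to the rows in `R` is unlikely to exist. The rows in `T` restricted
to the columns in `S` determine the relations between these columns, and given them, each other row
has to lie on a fixed hyperplane. The first factor counts the pairs `(S, T)`. -/
theorem pi_sparseOrthogonal_le {ι κ : Type*} [Fintype ι] [Fintype κ] (μ : ι → κ → Measure ℝ)
    [∀ i j, IsProbabilityMeasure (μ i j)] {q : ENNReal} (hq : q ≤ 1)
    (h : ∀ i j x, μ i j {x} ≤ q) (R : Finset ι) (k : ℕ) :
    Measure.pi (fun i => Measure.pi (μ i)) (sparseOrthogonal R k) ≤
      (Finset.univ.filter fun S : Finset κ => S.card ≤ k).card *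
        (Finset.univ.filter fun T : Finset ι => T.card ≤ k).card * q ^ (R.card - k) := by
  classical
  -- `A (S, T)`: some nonzero vector supported in `S` is orthogonal to the rows in `T`, and every
  -- such vector is orthogonal to the rows in `R`.
  let A : Finset κ × Finset ι → Set (ι → κ → ℝ) := fun P =>
    {x | ∃ w : κ → ℝ, w ≠ 0 ∧ (∀ l ∉ P.1, w l = 0) ∧ ∀ i ∈ P.2, ∑ l, w l * x i l = 0} \
      ⋃ i ∈ R, {x | ∃ w : κ → ℝ, (∀ l ∉ P.1, w l = 0) ∧
        (∀ i ∈ P.2, ∑ l, w l * x i l = 0) ∧ ∑ l, w l * x i l = 1}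
  have hA : ∀ P (x : ι → κ → ℝ), x ∈ A P → ∀ w : κ → ℝ, (∀ l ∉ P.1, w l = 0) →
      (∀ i ∈ P.2, ∑ l, w l * x i l = 0) → ∀ i ∈ R, ∑ l, w l * x i l = 0 := by
    intro P x hx w hS hT i hi
    by_contra hne
    refine hx.2 (Set.mem_biUnion hi ⟨fun l => (∑ l, w l * x i l)⁻¹ * w l, fun l hl => ?_,
      fun i' hi' => ?_, ?_⟩)
    · simp [hS l hl]
    · simp only [mul_assoc, ← Finset.mul_sum, hT i' hi', mul_zero]
    · simp only [mul_assoc, ← Finset.mul_sum]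
      exact inv_mul_cancel₀ hne
  have hAm : ∀ P, MeasurableSet (A P) := fun P =>
    (measurableSet_exists_orthogonal P.2 P.1).diff
      (MeasurableSet.iUnion fun i => MeasurableSet.iUnion fun _ =>
        measurableSet_exists_orthogonal_eq_one P.2 P.1 i)
  have hAle : ∀ P : Finset κ × Finset ι, P.2.card ≤ k →
      Measure.pi (fun i => Measure.pi (μ i)) (A P) ≤ q ^ (R.card - k) := by
    intro P hP
    refine pi_le_of_section_subset_box _ (fun i => i ∈ R \ P.2) (hAm P) fun z₀ hz₀ => ?_
    obtain ⟨w, hw, hS, hT⟩ := hz₀.1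
    refine ⟨fun _ => {y | ∑ l, w l * y l = 0}, fun z hz hzz i hi => ?_, ?_⟩
    · refine hA P z hz w hS (fun i' hi' => ?_) i (Finset.mem_sdiff.1 hi).1
      rw [hzz i' (by simp [hi'])]
      exact hT i' hi'
    · calc _ ≤ ∏ i ∈ Finset.univ.filter (fun i => i ∈ R \ P.2), q :=
            Finset.prod_le_prod' fun i _ => pi_hyperplane_le_one_sub (μ i) (h i) hw
        _ = q ^ (R \ P.2).card := by
            rw [Finset.prod_const, Finset.filter_mem_eq_inter, Finset.univ_inter]
        _ ≤ q ^ (R.card - k) := by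
            refine pow_le_pow_right_of_le_one' hq ?_
            have := Finset.le_card_sdiff P.2 R
            omega
  have hcover : (sparseOrthogonal R k : Set (ι → κ → ℝ)) ⊆
      ⋃ P ∈ (Finset.univ.filter fun S : Finset κ => S.card ≤ k) ×ˢ
        (Finset.univ.filter fun T : Finset ι => T.card ≤ k), A P := by
    rw [sparseOrthogonal_eq_iUnion]
    refine Set.iUnion_subset fun S x hx => ?_
    obtain ⟨w, hw, hS, hR⟩ := hx
    obtain ⟨T, hTR, hTS, hT⟩ := exists_small_row_basis x R S.1
    refine Set.mem_biUnion (x := (S.1, T)) ?_ ⟨⟨w, hw, hS, fun i hi => hR i (hTR hi)⟩, ?_⟩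
    · simpa [S.2] using hTS.trans S.2
    · simp only [Set.mem_iUnion, not_exists]
      rintro i hi ⟨w', hS', hT', h1⟩
      rw [hT w' hS' hT' i hi] at h1
      exact zero_ne_one h1
  calc _ ≤ _ := measure_mono hcover
    _ ≤ ∑ P ∈ (Finset.univ.filter fun S : Finset κ => S.card ≤ k) ×ˢ
        (Finset.univ.filter fun T : Finset ι => T.card ≤ k),
          Measure.pi (fun i => Measure.pi (μ i)) (A P) := measure_biUnion_finset_le _ _
    _ ≤ ∑ P ∈ (Finset.univ.filter fun S : Finset κ => S.card ≤ k) ×ˢ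
        (Finset.univ.filter fun T : Finset ι => T.card ≤ k), q ^ (R.card - k) :=
          Finset.sum_le_sum fun P hP =>
            hAle P (Finset.mem_filter.1 (Finset.mem_product.1 hP).2).2
    _ = _ := by rw [Finset.sum_const, Finset.card_product, nsmul_eq_mul]; push_cast; rfl

/-! ### Rows in the span of the others -/

theorem measurableSet_row_mem_span {ι κ : Type*} [Fintype ι] [Fintype κ] (i : ι) :
    MeasurableSet {x : ι → κ → ℝ | ∃ v : ι → ℝ, v i = 1 ∧ ∀ l, ∑ j, v j * x j l = 0} := by
  refine measurableSet_exists_of_isClosed (C := {p : (ι → κ → ℝ) × (ι → ℝ) |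
    p.2 i = 1 ∧ ∀ l, ∑ j, p.2 j * p.1 j l = 0}) ?_
  simp only [Set.ofPred_and, Set.ofPred_forall]
  exact (isClosed_eq (by fun_prop) continuous_const).inter
    (isClosed_iInter fun l => isClosed_eq (by fun_prop) continuous_const)

/-- If row `i` is a combination of the other rows, it lies on every hyperplane containing them.
Unless the other rows have a sparse normal vector, the Littlewood–Offord bound applies to it. -/
theorem pi_row_mem_span_le {ι : Type*} [Fintype ι] [DecidableEq ι] (μ : ι → ι → Measure ℝ)
    [∀ i j, IsProbabilityMeasure (μ i j)] {ρ : ℝ} (hρ : 0 < ρ) (hρ1 : ρ ≤ 1)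
    (h : ∀ i j x, (μ i j).real {x} ≤ 1 - ρ) (k : ℕ) (i : ι) :
    Measure.pi (fun i => Measure.pi (μ i))
        {x | ∃ v : ι → ℝ, v i = 1 ∧ ∀ l, ∑ j, v j * x j l = 0} ≤
      Measure.pi (fun i => Measure.pi (μ i)) (sparseOrthogonal (Finset.univ.erase i) k) +
        ENNReal.ofReal (4 / √(ρ * (k + 1 : ℕ))) := by
  set F : Set (ι → ι → ℝ) := {x | ∃ v : ι → ℝ, v i = 1 ∧ ∀ l, ∑ j, v j * x j l = 0}
  have hF : MeasurableSet F := measurableSet_row_mem_span i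
  have hsp := measurableSet_sparseOrthogonal (κ := ι) (Finset.univ.erase i) k
  calc _ ≤ Measure.pi (fun i => Measure.pi (μ i)) (sparseOrthogonal (Finset.univ.erase i) k ∪
        F \ sparseOrthogonal (Finset.univ.erase i) k) :=
        measure_mono (by rw [Set.union_sdiff_self]; exact Set.subset_union_right)
    _ ≤ _ := measure_union_le _ _
    _ ≤ _ := by
      gcongr
      refine pi_le_of_section_subset_box _ (· = i) (hF.diff hsp) fun z₀ hz₀ => ?_
      -- The other rows are fewer than the dimension, so they have a common normal vector.
      obtain ⟨w, hw, hw0⟩ : ∃ w : ι → ℝ, w ≠ 0 ∧ ∀ j ≠ i, ∑ l, w l * z₀ j l = 0 := by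
        let φ : (ι → ℝ) →ₗ[ℝ] ({j // j ≠ i} → ℝ) :=
          LinearMap.pi fun j => ∑ l, z₀ j l • LinearMap.proj l
        have hker : LinearMap.ker φ ≠ ⊥ := by
          apply LinearMap.ker_ne_bot_of_finrank_lt
          rw [Module.finrank_fintype_fun_eq_card, Module.finrank_fintype_fun_eq_card]
          exact Fintype.card_subtype_lt (x := i) (by simp)
        obtain ⟨w, hw, hw0⟩ := Submodule.exists_mem_ne_zero_of_ne_bot hker
        refine ⟨w, hw0, fun j hj => ?_⟩
        have := congrFun (LinearMap.mem_ker.1 hw) ⟨j, hj⟩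
        simpa [φ, mul_comm] using this
      have hcard : k + 1 ≤ (Finset.univ.filter fun l => w l ≠ 0).card := by
        by_contra hlt
        exact hz₀.2 ⟨w, hw, by omega, fun j hj => hw0 j (Finset.ne_of_mem_erase hj)⟩
      refine ⟨fun _ => {y | ∑ l, w l * y l = 0}, ?_, ?_⟩
      · rintro z ⟨⟨v, hv, hvz⟩, -⟩ hzz _ rfl
        have hsum : ∑ j, v j * ∑ l, w l * z j l = 0 := by
          simp_rw [Finset.mul_sum]
          rw [Finset.sum_comm]
          refine Finset.sum_eq_zero fun l _ => ?_
          rw [← mul_zero (w l), ← hvz l, Finset.mul_sum]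
          exact Finset.sum_congr rfl fun j _ => by ring
        rw [Finset.sum_eq_single _ (fun j _ hj => by rw [hzz j hj, hw0 j hj, mul_zero])
          (by simp), hv, one_mul] at hsum
        exact hsum
      · rw [Finset.filter_eq' Finset.univ i, if_pos (Finset.mem_univ i), Finset.prod_singleton,
          ENNReal.le_ofReal_iff_toReal_le (measure_ne_top _ _) (by positivity)]
        exact pi_hyperplane_le (μ i) hρ hρ1 (h i) w k.succ_pos hcard


/-- The law of an array with independent entries, as a product over the rows of product laws. -/
theorem measurePreserving_array_of_iIndepFun {Ω ι κ : Type*} [Fintype ι] [Fintype κ]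
    [MeasurableSpace Ω] {P : Measure Ω} [IsProbabilityMeasure P] {X : ι → κ → Ω → ℝ}
    (hX : ∀ i j, Measurable (X i j)) (h : iIndepFun (fun p : ι × κ => X p.1 p.2) P) :
    MeasurePreserving (fun ω i j => X i j ω) P
      (Measure.pi fun i => Measure.pi fun j => P.map (X i j)) := by
  have hpm : ∀ i j, IsProbabilityMeasure (P.map (X i j)) := fun i j =>
    Measure.isProbabilityMeasure_map (hX i j).aemeasurable
  have hlaw := (iIndepFun_iff_map_fun_eq_pi_map
    (fun p : ι × κ => (hX p.1 p.2).aemeasurable)).1 h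
  have huncurry : (Measure.pi fun i => Measure.pi fun j => P.map (X i j)).map
      (MeasurableEquiv.curry ι κ ℝ).symm = Measure.pi fun p : ι × κ => P.map (X p.1 p.2) := by
    refine (Measure.pi_eq fun s _ => ?_).symm
    rw [MeasurableEquiv.map_apply]
    have : (MeasurableEquiv.curry ι κ ℝ).symm ⁻¹' Set.pi Set.univ s =
        Set.pi Set.univ fun i => Set.pi Set.univ fun j => s (i, j) := by
      ext x
      simp [Set.mem_pi, MeasurableEquiv.curry, Function.uncurry]
    rw [this, Measure.pi_pi]
    simp_rw [Measure.pi_pi]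
    rw [Fintype.prod_prod_type]
  refine ⟨measurable_pi_lambda _ fun i => measurable_pi_lambda _ fun j => hX i j, ?_⟩
  rw [← MeasurableEquiv.map_map_symm (MeasurableEquiv.curry ι κ ℝ)
    (ν := Measure.pi fun i => Measure.pi fun j => P.map (X i j)), huncurry, ← hlaw,
    Measure.map_map (MeasurableEquiv.measurable _)
      (measurable_pi_lambda _ fun p : ι × κ => hX p.1 p.2)]
  rfl

/-- Markov's inequality for the number of events that occur. -/
theorem natCast_mul_measure_le_sum {Ω ι : Type*} [Fintype ι] [MeasurableSpace Ω] (P : Measure Ω)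
    (m : ℕ) {B : Set Ω} (hB : MeasurableSet B) {F : ι → Set Ω} (hF : ∀ i, MeasurableSet (F i))
    (h : ∀ ω ∈ B, ∃ I : Finset ι, m ≤ I.card ∧ ∀ i ∈ I, ω ∈ F i) :
    (m : ENNReal) * P B ≤ ∑ i, P (F i) := by
  classical
  calc (m : ENNReal) * P B = ∫⁻ ω, B.indicator (fun _ => (m : ENNReal)) ω ∂P := by
        rw [lintegral_indicator_const hB]
    _ ≤ ∫⁻ ω, ∑ i, (F i).indicator (fun _ => (1 : ENNReal)) ω ∂P := by
        refine lintegral_mono fun ω => ?_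
        by_cases hω : ω ∈ B
        · obtain ⟨I, hI, hIF⟩ := h ω hω
          rw [Set.indicator_of_mem hω]
          calc (m : ENNReal) ≤ I.card := by exact_mod_cast hI
            _ = ∑ i ∈ I, (F i).indicator (fun _ => (1 : ENNReal)) ω := by
                rw [Finset.sum_congr rfl fun i hi => Set.indicator_of_mem (hIF i hi) _]
                simp
            _ ≤ _ := Finset.sum_le_sum_of_subset (Finset.subset_univ I)
        · rw [Set.indicator_of_notMem hω]
          exact zero_le
    _ = ∑ i, P (F i) := by
        rw [lintegral_finsetSum _ fun i _ => measurable_const.indicator (hF i)]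
        simp_rw [lintegral_indicator_const (hF _), one_mul]

/-- The singularity probability in terms of a sparsity threshold `k`: the first term bounds the
probability of a sparse row relation, the bracket that of a given row being in the span of the
other rows. A relation with more than `k` terms makes more than `k` rows dependent on the others. -/
theorem measure_not_isUnit_le {Ω : Type*} [MeasurableSpace Ω] (P : Measure Ω)
    [IsProbabilityMeasure P] {n : ℕ} (M : Ω → Matrix (Fin n) (Fin n) ℝ)
    (hM : ∀ i j, Measurable fun ω => M ω i j)
    (hind : iIndepFun (fun (p : Fin n × Fin n) (ω : Ω) => M ω p.1 p.2) P) {ρ : ℝ} (hρ : 0 < ρ)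
    (hρ1 : ρ ≤ 1) (hatom : ∀ i j x, (P.map fun ω => M ω i j).real {x} ≤ 1 - ρ) (k : ℕ) :
    P.real {ω | ¬ IsUnit (M ω)} ≤
      ((Finset.univ.filter fun S : Finset (Fin n) => S.card ≤ k).card : ℝ) ^ 2 *
          (1 - ρ) ^ (n - 1 - k) +
        n / (k + 1) * (((Finset.univ.filter fun S : Finset (Fin n) => S.card ≤ k).card : ℝ) ^ 2 *
          (1 - ρ) ^ (n - 1 - k) + 4 / √(ρ * (k + 1 : ℕ))) := by
  classical
  have hpm : ∀ i j, IsProbabilityMeasure (P.map fun ω => M ω i j) := fun i j =>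
    Measure.isProbabilityMeasure_map (hM i j).aemeasurable
  set N : ℕ := (Finset.univ.filter fun S : Finset (Fin n) => S.card ≤ k).card with hN
  set q : ENNReal := ENNReal.ofReal (1 - ρ) with hq
  have hq1 : q ≤ 1 := by
    rw [hq, ← ENNReal.ofReal_one]
    exact ENNReal.ofReal_le_ofReal (by linarith)
  have hatom' : ∀ i j x, (P.map fun ω => M ω i j) {x} ≤ q := fun i j x => by
    rw [hq, ENNReal.le_ofReal_iff_toReal_le (measure_ne_top _ _) (by linarith)]
    exact hatom i j x
  have hrow := measurePreserving_array_of_iIndepFun (X := fun i j ω => M ω i j) hM hind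
  have hcol := measurePreserving_array_of_iIndepFun (X := fun j i ω => M ω i j)
    (fun j i => hM i j) (hind.precomp Prod.swap_injective)
  let r : Ω → Fin n → Fin n → ℝ := fun ω i j => M ω i j
  let c : Ω → Fin n → Fin n → ℝ := fun ω j i => M ω i j
  let s : ENNReal := (N : ENNReal) * N * q ^ (n - 1 - k)
  let L : ENNReal := ENNReal.ofReal (4 / √(ρ * (k + 1 : ℕ)))
  let F : Fin n → Set Ω := fun i =>
    r ⁻¹' {x | ∃ v : Fin n → ℝ, v i = 1 ∧ ∀ l, ∑ j, v j * x j l = 0}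
  have hFm : ∀ i, MeasurableSet (F i) := fun i => hrow.measurable (measurableSet_row_mem_span i)
  have hF : ∀ i, P (F i) ≤ s + L := by
    intro i
    rw [hrow.measure_preimage (measurableSet_row_mem_span i).nullMeasurableSet]
    refine (pi_row_mem_span_le _ hρ hρ1 hatom k i).trans ?_
    gcongr
    refine (pi_sparseOrthogonal_le _ hq1 hatom' _ k).trans (le_of_eq ?_)
    rw [Finset.card_erase_of_mem (Finset.mem_univ i), Finset.card_univ, Fintype.card_fin]
  -- With threshold `n`, the sparsity condition is void.
  let Sing : Set Ω := c ⁻¹' sparseOrthogonal Finset.univ n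
  let Sp : Set Ω := c ⁻¹' sparseOrthogonal Finset.univ k
  have hSm : MeasurableSet Sing := hcol.measurable (measurableSet_sparseOrthogonal _ _)
  have hSpm : MeasurableSet Sp := hcol.measurable (measurableSet_sparseOrthogonal _ _)
  have hSp : P Sp ≤ s := by
    rw [hcol.measure_preimage (measurableSet_sparseOrthogonal _ _).nullMeasurableSet]
    refine (pi_sparseOrthogonal_le _ hq1 (fun i j => hatom' j i) _ k).trans ?_
    rw [Finset.card_univ, Fintype.card_fin]
    exact mul_le_mul_right (pow_le_pow_right_of_le_one' hq1 (by omega)) _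
  have hsing : {ω | ¬ IsUnit (M ω)} ⊆ Sing := by
    intro ω hω
    rw [Set.mem_ofPred_eq, Matrix.isUnit_iff_isUnit_det, isUnit_iff_ne_zero, not_not] at hω
    obtain ⟨v, hv, hv0⟩ := Matrix.exists_vecMul_eq_zero_iff.2 hω
    exact ⟨v, hv, (Finset.card_le_univ _).trans (by simp), fun l _ => congrFun hv0 l⟩
  have hcount : ((k + 1 : ℕ) : ENNReal) * P (Sing \ Sp) ≤ ∑ i, P (F i) := by
    refine natCast_mul_measure_le_sum P (k + 1) (hSm.diff hSpm) hFm ?_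
    rintro ω ⟨⟨v, hv, -, hv0⟩, hsp⟩
    refine ⟨Finset.univ.filter fun i => v i ≠ 0, ?_, fun i hi => ?_⟩
    · by_contra hlt
      exact hsp ⟨v, hv, by omega, hv0⟩
    · refine ⟨fun j => (v i)⁻¹ * v j, inv_mul_cancel₀ (Finset.mem_filter.1 hi).2, fun l => ?_⟩
      have := hv0 l (Finset.mem_univ l)
      simp only [mul_assoc, ← Finset.mul_sum]
      exact mul_eq_zero_of_right _ this
  have hcount' : ((k + 1 : ℕ) : ENNReal) * P (Sing \ Sp) ≤ n * (s + L) := by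
    refine hcount.trans ((Finset.sum_le_sum fun i _ => hF i).trans ?_)
    simp [mul_add]
  have hsR : s = ENNReal.ofReal ((N : ℝ) ^ 2 * (1 - ρ) ^ (n - 1 - k)) := by
    rw [ENNReal.ofReal_mul (by positivity), ENNReal.ofReal_pow (by linarith),
      ENNReal.ofReal_pow (by positivity), ENNReal.ofReal_natCast, sq]
  set σ : ℝ := (N : ℝ) ^ 2 * (1 - ρ) ^ (n - 1 - k) with hσ
  have hσ0 : 0 ≤ σ := mul_nonneg (by positivity) (pow_nonneg (by linarith) _)
  have h1 : P.real Sp ≤ σ := by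
    rw [hsR] at hSp
    exact ENNReal.toReal_le_of_le_ofReal hσ0 hSp
  have h2 : ((k + 1 : ℕ) : ℝ) * P.real (Sing \ Sp) ≤ n * (σ + 4 / √(ρ * (k + 1 : ℕ))) := by
    rw [hsR, ← ENNReal.ofReal_add hσ0 (by positivity), ← ENNReal.ofReal_natCast n,
      ← ENNReal.ofReal_mul (by positivity)] at hcount'
    have := ENNReal.toReal_le_of_le_ofReal (by positivity) hcount'
    rwa [ENNReal.toReal_mul, ENNReal.toReal_natCast] at this
  have h3 : P.real (Sing \ Sp) ≤ n / (k + 1) * (σ + 4 / √(ρ * (k + 1 : ℕ))) := by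
    rw [div_mul_eq_mul_div, le_div_iff₀ (by positivity), mul_comm]
    exact_mod_cast h2
  calc P.real {ω | ¬ IsUnit (M ω)} ≤ P.real (Sp ∪ Sing \ Sp) :=
        measureReal_mono (hsing.trans (by rw [Set.union_sdiff_self]; exact Set.subset_union_right))
    _ ≤ P.real Sp + P.real (Sing \ Sp) := measureReal_union_le _ _
    _ ≤ _ := add_le_add h1 h3

/-! ### The entropy estimate and the conclusion -/

theorem card_filter_card_le_mul_pow_le {α : Type*} [Fintype α] {t : ℝ} (ht : 0 ≤ t) (ht1 : t ≤ 1)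
    (k : ℕ) : ((Finset.univ.filter fun S : Finset α => S.card ≤ k).card : ℝ) * t ^ k ≤
      (1 + t) ^ Fintype.card α := by
  calc ((Finset.univ.filter fun S : Finset α => S.card ≤ k).card : ℝ) * t ^ k
      = ∑ S ∈ Finset.univ.filter fun S : Finset α => S.card ≤ k, t ^ k := by
        rw [Finset.sum_const, nsmul_eq_mul]
    _ ≤ ∑ S ∈ Finset.univ.filter fun S : Finset α => S.card ≤ k, t ^ S.card :=
        Finset.sum_le_sum fun S hS => pow_le_pow_of_le_one ht ht1 (Finset.mem_filter.1 hS).2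
    _ ≤ ∑ S : Finset α, t ^ S.card :=
        Finset.sum_le_sum_of_subset_of_nonneg (Finset.filter_subset _ _)
          fun _ _ _ => by positivity
    _ = (1 + t) ^ Fintype.card α := by
        rw [add_comm, ← Fintype.sum_pow_mul_eq_add_pow]
        simp

theorem natCast_mul_pow_le {r : ℝ} (hr : 0 ≤ r) (hr1 : r < 1) (n : ℕ) :
    n * r ^ n ≤ 1 / (1 - r) := by
  calc n * r ^ n = ∑ _i ∈ Finset.range n, r ^ n := by simp
    _ ≤ ∑ i ∈ Finset.range n, r ^ i := Finset.sum_le_sum fun i hi =>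
        pow_le_pow_of_le_one hr hr1.le (Finset.mem_range.1 hi).le
    _ ≤ 1 / (1 - r) := by
        rw [geom_sum_eq hr1.ne, ← neg_div_neg_eq, neg_sub, neg_sub]
        exact div_le_div_of_nonneg_right (by linarith [pow_nonneg hr n]) (by linarith)

/-- For a small enough proportion `1 / m`, exponential decay beats the entropy of the pairs of sets
of at most `n / m` indices. -/
theorem exists_card_sq_mul_pow_le {q : ℝ} (hq : 0 < q) (hq1 : q < 1) :
    ∃ (m : ℕ) (C : ℝ), 2 ≤ m ∧ 0 ≤ C ∧ ∀ n : ℕ, 1 ≤ n →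
      ((Finset.univ.filter fun S : Finset (Fin n) => S.card ≤ n / m).card : ℝ) ^ 2 *
        q ^ (n - 1 - n / m) ≤ C / √n := by
  -- `r ^ 4 = q`: one factor `r ^ n` pays for `(1 + t) ^ (2 * n)`, one for the powers with
  -- exponent `k = n / m`, and a third one for `√n`.
  set r : ℝ := √√q with hr
  have hr0 : 0 < r := Real.sqrt_pos.2 (Real.sqrt_pos.2 hq)
  have hrq : r ^ 4 = q := by
    rw [hr, show 4 = 2 * 2 from rfl, pow_mul, Real.sq_sqrt (Real.sqrt_nonneg _),
      Real.sq_sqrt hq.le]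
  have hr1 : r < 1 := by
    by_contra h
    have := one_le_pow₀ (n := 4) (not_lt.1 h)
    linarith
  have hs0 : 0 < √r := Real.sqrt_pos.2 hr0
  have hs1 : √r < 1 := (Real.sqrt_lt' one_pos).2 (by simpa using hr1)
  obtain ⟨t, ht0, ht1, ht⟩ : ∃ t : ℝ, 0 < t ∧ t ≤ 1 ∧ (1 + t) ^ 2 * r ≤ 1 := by
    refine ⟨min 1 (1 / √r - 1), lt_min one_pos ?_, min_le_left _ _, ?_⟩
    · rw [sub_pos, one_lt_div hs0]
      exact hs1
    · have h1 : 1 + min 1 (1 / √r - 1) ≤ 1 / √r := by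
        linarith [min_le_right 1 (1 / √r - 1)]
      have h0 : 0 ≤ 1 + min 1 (1 / √r - 1) := by
        have : 0 ≤ 1 / √r - 1 := by
          rw [sub_nonneg, one_le_div hs0]
          exact hs1.le
        positivity
      calc (1 + min 1 (1 / √r - 1)) ^ 2 * r ≤ (1 / √r) ^ 2 * r := by gcongr
        _ = 1 := by rw [div_pow, Real.sq_sqrt hr0.le]; field_simp
  obtain ⟨m₀, hm₀⟩ := exists_pow_lt_of_lt_one (show 0 < t ^ 2 * q by positivity) hr1
  set m := m₀ + 2 with hm
  have hmle : r ^ m ≤ t ^ 2 * q :=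
    (pow_le_pow_of_le_one hr0.le hr1.le (by omega)).trans hm₀.le
  refine ⟨m, 1 / q * (1 / (1 - r)), by omega, by
    have : 0 < 1 - r := by linarith
    positivity, fun n hn => ?_⟩
  set k := n / m with hk
  set N : ℝ := ((Finset.univ.filter fun S : Finset (Fin n) => S.card ≤ k).card : ℝ) with hN
  have hkm : m * k ≤ n := Nat.mul_div_le n m
  have hkn : k + 1 ≤ n := by
    have : 2 * k ≤ m * k := Nat.mul_le_mul_right k (by omega)
    omega
  have hcard : N * t ^ k ≤ (1 + t) ^ n := by
    simpa using card_filter_card_le_mul_pow_le (α := Fin n) ht0.le ht1 k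
  have hpow : q ^ (n - 1 - k) * q ^ k * q = r ^ n * r ^ n * r ^ n * r ^ n := by
    rw [← pow_add, ← pow_succ, show n - 1 - k + k + 1 = n by omega, ← hrq, ← pow_mul]
    ring
  have hrn : 0 < r ^ n := by positivity
  have hk' : r ^ n ≤ t ^ (2 * k) * q ^ k := by
    calc r ^ n ≤ r ^ (m * k) := pow_le_pow_of_le_one hr0.le hr1.le hkm
      _ = (r ^ m) ^ k := pow_mul _ _ _
      _ ≤ (t ^ 2 * q) ^ k := by gcongr
      _ = t ^ (2 * k) * q ^ k := by rw [mul_pow, pow_mul]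
  have hent : (N * t ^ k) ^ 2 * r ^ n ≤ 1 := by
    calc (N * t ^ k) ^ 2 * r ^ n ≤ ((1 + t) ^ n) ^ 2 * r ^ n := by gcongr
      _ = ((1 + t) ^ 2 * r) ^ n := by rw [mul_pow, ← pow_mul, ← pow_mul, mul_comm n]
      _ ≤ 1 := pow_le_one₀ (by positivity) ht
  have hmain : N ^ 2 * q ^ (n - 1 - k) ≤ 1 / q * r ^ n := by
    rw [div_mul_eq_mul_div, one_mul, le_div_iff₀ hq]
    have hpos : 0 < t ^ (2 * k) * q ^ k := by positivity
    refine le_of_mul_le_mul_right ?_ hpos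
    calc N ^ 2 * q ^ (n - 1 - k) * q * (t ^ (2 * k) * q ^ k)
        = (N * t ^ k) ^ 2 * (q ^ (n - 1 - k) * q ^ k * q) := by ring
      _ = (N * t ^ k) ^ 2 * r ^ n * (r ^ n * r ^ n * r ^ n) := by rw [hpow]; ring
      _ ≤ 1 * (r ^ n * r ^ n * r ^ n) := by gcongr
      _ ≤ r ^ n * r ^ n := by
          have : r ^ n ≤ 1 := pow_le_one₀ hr0.le hr1.le
          rw [one_mul]
          exact mul_le_of_le_one_right (by positivity) this
      _ ≤ r ^ n * (t ^ (2 * k) * q ^ k) := by gcongr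
  have hn0 : (1 : ℝ) ≤ n := by exact_mod_cast hn
  have hsq : 0 < √(n : ℝ) := Real.sqrt_pos.2 (by linarith)
  rw [le_div_iff₀ hsq]
  calc N ^ 2 * q ^ (n - 1 - k) * √n ≤ 1 / q * r ^ n * n := by
        gcongr
        exact Real.sqrt_le_iff.2 ⟨by linarith, le_self_pow₀ hn0 two_ne_zero⟩
    _ = 1 / q * (n * r ^ n) := by ring
    _ ≤ 1 / q * (1 / (1 - r)) := by
        gcongr
        exact natCast_mul_pow_le hr0.le hr1 n

/-- No value is taken with probability more than `1 - ρ`, as it cannot be both above `x⁺` and below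
`x⁻`. -/
theorem UniformlyNondegenerate.map_real_singleton_le {Ω : Type*} [MeasurableSpace Ω]
    {P : Measure Ω} [IsProbabilityMeasure P] {ρ : ℝ} {n : ℕ} {M : Ω → Matrix (Fin n) (Fin n) ℝ}
    (hM : ∀ i j, Measurable fun ω => M ω i j) (h : UniformlyNondegenerate P ρ M) (i j : Fin n)
    (x : ℝ) : (P.map fun ω => M ω i j).real {x} ≤ 1 - ρ := by
  obtain ⟨a, b, hab, hb, ha⟩ := h i j
  rw [map_measureReal_apply (hM i j) (measurableSet_singleton x)]
  have key : ∀ U : Set ℝ, MeasurableSet U → x ∉ U → ρ < P.real {ω | M ω i j ∈ U} →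
      P.real ((fun ω => M ω i j) ⁻¹' {x}) ≤ 1 - ρ := by
    intro U hU hx hlt
    have hsub : (fun ω => M ω i j) ⁻¹' {x} ⊆ ((fun ω => M ω i j) ⁻¹' U)ᶜ := by
      intro ω hω hω'
      rw [Set.mem_preimage, Set.mem_singleton_iff] at hω
      exact hx (hω ▸ hω')
    have := measureReal_mono (μ := P) hsub
    rw [probReal_compl_eq_one_sub (hM i j hU)] at this
    change ρ < P.real ((fun ω => M ω i j) ⁻¹' U) at hlt
    linarith
  rcases le_total x b with hx | hx
  · exact key (Set.Ioi b) measurableSet_Ioi (by simpa using hx) hb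
  · exact key (Set.Iio a) measurableSet_Iio (by simpa using (hab.trans_le hx).le) ha

theorem proposition1 (ρ : ℝ) (hρ : ρ ∈ Set.Ioo (0 : ℝ) (1 / 2)) :
    ∃ C : ℝ, ∀ (n : ℕ), 1 ≤ n →
      ∀ (Ω : Type*) [MeasurableSpace Ω] (P : Measure Ω) [IsProbabilityMeasure P]
        (M : Ω → Matrix (Fin n) (Fin n) ℝ),
        (∀ i j : Fin n, Measurable (fun ω => M ω i j)) →
        iIndepFun (fun (p : Fin n × Fin n) (ω : Ω) => M ω p.1 p.2) P →
        UniformlyNondegenerate P ρ M →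
        P.real {ω | ¬ IsUnit (M ω)} ≤ C / Real.sqrt (n : ℝ) := by
  obtain ⟨hρ0, hρ2⟩ := hρ
  obtain ⟨m, C, hm, hC, hsparse⟩ :=
    exists_card_sq_mul_pow_le (q := 1 - ρ) (by linarith) (by linarith)
  refine ⟨C + m * (C + 4 * √(m / ρ)), fun n hn Ω _ P _ M hM hind hH => ?_⟩
  have hle := measure_not_isUnit_le P M hM hind hρ0 (by linarith)
    (hH.map_real_singleton_le hM) (n / m)
  have hm0 : (0 : ℝ) < m := by exact_mod_cast (by omega : 0 < m)
  have hn0 : (0 : ℝ) < n := by exact_mod_cast hn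
  have hk : (n : ℝ) ≤ m * ((n / m : ℕ) + 1) := by
    exact_mod_cast (Nat.lt_mul_div_succ n (by omega : 0 < m)).le
  have hratio : (n : ℝ) / ((n / m : ℕ) + 1) ≤ m := by
    rw [div_le_iff₀ (by positivity)]
    exact hk
  have hLO : 4 / √(ρ * ((n / m + 1 : ℕ) : ℝ)) ≤ 4 * √(m / ρ) / √n := by
    rw [mul_div_assoc, ← Real.sqrt_div (by positivity), ← mul_one_div]
    gcongr
    rw [one_div, ← Real.sqrt_inv]
    apply Real.sqrt_le_sqrt
    rw [inv_le_comm₀ (by positivity) (by positivity), inv_div, div_div_eq_mul_div,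
      div_le_iff₀ hm0]
    push_cast
    nlinarith
  calc P.real {ω | ¬ IsUnit (M ω)} ≤ _ := hle
    _ ≤ C / √n + m * (C / √n + 4 * √(m / ρ) / √n) := by
        have := hsparse n hn
        have : 0 ≤ (1 - ρ) ^ (n - 1 - n / m) := pow_nonneg (by linarith) _
        gcongr
    _ = (C + m * (C + 4 * √(m / ρ))) / √n := by ring
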